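/- **Setting.** Let $d\ge 1$, $k,m\ge 0$, let $\mathbf{x}_1,\dots,\mathbf{x}_m\in\mathbb{R}^d$, $y_1,\dots,y_m\in\mathbb{R}$, and let $\ell:\mathbb{R}\times\mathbb{R}\to\mathbb{R}$ be a loss such that for every $y$ the function $z\mapsto\ell(z,y)$ is convex and $\beta$-smooth (differentiable with $\beta$-Lipschitz derivative $\ell'(\cdot,y)$). The empirical risk is $R(f)=\frac1m\sum_{i=1}^m\ell(f(\mathbf{x}_i),y_i)$, and for functions $f,g$ on $\mathbb{R}^d$ put $D_f(g)=\frac1m\sum_{i=1}^m\ell'(f(\mathbf{x}_i),y_i)\,g(\mathbf{x}_i)$. Let $$\mathcal V_i=\Big\{\mathbf{x}\mapsto\prod_{j=1}^i\mathbf{w}_j^\top\mathbf{x}:\ \|\mathbf{w}_j\|_2=1\ \forall j\Big\},\qquad \mathcal V=\mathcal V_1\cup\mathcal V_2\cup\mathcal V_3,$$ $$\mathcal P_{3,k}=\Big\{\mathbf{x}\mapsto\sum_{i=1}^k\alpha_i g_i(\mathbf{x}):\ |\alpha_i|\le1,\ g_i\in\mathcal V\Big\}.$$ The data are normalized so that $\frac1m\sum_{i=1}^m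 g(\mathbf{x}_i)^2\le 1$ for all $g\in\mathcal V$ (this holds, for instance, if $\|\mathbf{x}_i\|_2\le1$ for all $i$). $\mathcal N_{t,n,\sigma_2}$ is the class of functions computed by networks with $t$ layers and $n$ neurons (all neurons count except the inputs): $t-1$ hidden layers whose neurons apply $\sigma_2(z)=z^2$ to an affine function of the outputs of the preceding layer and of the input vector $\mathbf{x}$ (direct connections from the input are allowed), and one linear output neuron with the same kinds of inputs. Weights are unbounded. **Algorithm (GECO).** Fix $\delta\in(0,1)$, $\tau\in[0,1)$ and put $s=\lceil 2d\log(1/\delta)\rceil$. Start with $f^{(0)}=0$. In iteration $t=1,\dots,r$, with $f=f^{(t-1)}$: 1. Compute a unit vector $\mathbf{a}$ for which $D_f(\mathbf{x}\mapsto\mathbf{a}^\top\mathbf{x})$ is at least $(1-\tau)$ times the maximum of this quantity over unit vectors, and unit vectors $\mathbf{b},\mathbf{c}$ for which $D_f(\mathbf{x}\mapsto(\mathbf{b}^\top\mathbf{x})(\mathbf{c}^\top\mathbf{x}))$ is at least $(1-\tau)$ times its maximum over pairs of unit vectors. 2. (Approximate tensor maximization.) Let $F(\mathbf{w},\mathbf{u},\mathbf{v})=D_f\big(\mathbf{x}\mapsto(\mathbf{w}^\top\mathbf{x})(\mathbf{u}^\top\mathbf{x})(\mathbf{v}^\top\mathbf{x})\big)$.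 Draw fresh i.i.d. $\mathbf{w}_1,\dots,\mathbf{w}_s\sim N(0,I_d)$, independent of everything that happened in earlier iterations, replace each $\mathbf{w}_i$ by $\mathbf{w}_i/\|\mathbf{w}_i\|$, and find unit vectors $\mathbf{u}_i,\mathbf{v}_i$ with $F(\mathbf{w}_i,\mathbf{u}_i,\mathbf{v}_i)\ge(1-\tau)\max_{\|\mathbf{u}\|=\|\mathbf{v}\|=1}F(\mathbf{w}_i,\mathbf{u},\mathbf{v})$. Keep a triple $(\mathbf{w}_i,\mathbf{u}_i,\mathbf{v}_i)$ with the largest value of $F$. 3. Let $g_t$ be one, among the three functions obtained from $\mathbf{a}$, from $(\mathbf{b},\mathbf{c})$ and from the kept triple, with the largest value of $D_f$. 4. Let $f^{(t)}$ be a minimizer of $R$ over the linear span of $g_1,\dots,g_t$. All choices (of approximate maximizers, in ties, of minimizers) are arbitrary, as long as they are such that $f^{(t)}$ is a measurable function of the information available after iteration $t$. The output is $f=f^{(r)}$. **Theorem.** Let $\epsilon>0$. If GECO is run for $$r>\frac{4d\beta k^2}{\epsilon(1-\tau)^2}$$ iterations, then $\min_{f^*\in\mathcal P_{3,k}}R(f^*)$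 is attained, and with probability at least $(1-\delta)^r$ the output satisfies $f\in\mathcal N_{3,5r,\sigma_2}$ and $$R(f)\le\min_{f^*\in\mathcal P_{3,k}}R(f^*)+\epsilon .$$ -/

import Mathlib

open MeasureTheory ProbabilityTheory
open scoped RealInnerProductSpace

noncomputable section

namespace PolyNet

/-- The instance space: real vectors of length `d` with the Euclidean norm. -/
abbrev Vec (d : ℕ) : Type := EuclideanSpace ℝ (Fin d)

/-! ### Networks -/

/-- `HiddenLayers σ d t n w h`: the map `h` is computed by the last of `t` consecutive hidden
layers on inputs of dimension `d`; these layers have `n` neurons altogether and the last one has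
`w` neurons. Every neuron applies the activation `σ` to an affine function of the outputs of the
preceding layer and of the input vector (direct connections from the input are allowed). -/
inductive HiddenLayers (σ : ℝ → ℝ) (d : ℕ) :
    (t n w : ℕ) → (Vec d → Fin w → ℝ) → Prop
  | input : HiddenLayers σ d 0 0 0 (fun _ i => i.elim0)
  | layer {t n w : ℕ} {h : Vec d → Fin w → ℝ} (w' : ℕ)
      (A : Fin w' → Fin w → ℝ) (U : Fin w' → Vec d) (b : Fin w' → ℝ)
      (hh : HiddenLayers σ d t n w h) :
      HiddenLayers σ d (t + 1) (n + w') w'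
        (fun x j => σ ((∑ i, A j i * h x i) + ⟪U j, x⟫ + b j))

/-- The class of functions computed by networks with `t` layers, `n` neurons (all neurons count,
except the input neurons) and activation `σ`: there are `t - 1` hidden layers and one further
layer, consisting of a single linear output neuron with a bias. Weights are unbounded. -/
def networkClass (d t n : ℕ) (σ : ℝ → ℝ) : Set (Vec d → ℝ) :=
  {f | ∃ (s p w : ℕ) (h : Vec d → Fin w → ℝ), t = s + 1 ∧ n = p + 1 ∧
    HiddenLayers σ d s p w h ∧
    ∃ (a : Fin w → ℝ) (u : Vec d) (b : ℝ), f = fun x => (∑ i, a i * h x i) + ⟪u, x⟫ + b}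

/-- The squared activation function. -/
def sqAct (z : ℝ) : ℝ := z ^ 2

/-! ### The hidden units and the cubic class -/

/-- The product of linear forms `x ↦ ∏ j, ⟨w j, x⟩`. -/
def linProd {d i : ℕ} (w : Fin i → Vec d) : Vec d → ℝ := fun x => ∏ j, ⟪w j, x⟫

/-- The class `V_i` of products of `i` linear forms with unit weight vectors. -/
def unitProducts (d i : ℕ) : Set (Vec d → ℝ) :=
  {g | ∃ w : Fin i → Vec d, (∀ j, ‖w j‖ = 1) ∧ g = linProd w}

/-- The class `V = V_1 ∪ V_2 ∪ V_3`. -/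
def hiddenUnits (d : ℕ) : Set (Vec d → ℝ) :=
  unitProducts d 1 ∪ unitProducts d 2 ∪ unitProducts d 3

/-- The class `P_{3,k}`: sums of `k` members of `V` with coefficients in `[-1, 1]`. -/
def cubicClass (d k : ℕ) : Set (Vec d → ℝ) :=
  {f | ∃ (a : Fin k → ℝ) (g : Fin k → Vec d → ℝ),
    (∀ i, |a i| ≤ 1) ∧ (∀ i, g i ∈ hiddenUnits d) ∧ f = fun x => ∑ i, a i * g i x}

/-! ### Loss and empirical risk -/

/-- A differentiable real function whose derivative is `β`-Lipschitz. -/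
def IsSmoothWith (β : ℝ) (φ : ℝ → ℝ) : Prop :=
  Differentiable ℝ φ ∧ ∀ a b, |deriv φ a - deriv φ b| ≤ β * |a - b|

/-- The empirical risk `R(f) = (1/m) ∑ i, ℓ (f (x i)) (y i)`. -/
def risk {d m : ℕ} (l : ℝ → ℝ → ℝ) (x : Fin m → Vec d) (y : Fin m → ℝ) (f : Vec d → ℝ) : ℝ :=
  (1 / (m : ℝ)) * ∑ i, l (f (x i)) (y i)

/-- The first order term `(1/m) ∑ i, ℓ' (f (x i)) (y i) * g (x i)` of `R (f + η g)` in `η`, where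
`ℓ'` is the derivative of the loss in its first argument. -/
def riskSlope {d m : ℕ} (l : ℝ → ℝ → ℝ) (x : Fin m → Vec d) (y : Fin m → ℝ) (f g : Vec d → ℝ) : ℝ :=
  (1 / (m : ℝ)) * ∑ i, deriv (fun z => l z (y i)) (f (x i)) * g (x i)

/-! ### The algorithm -/

/-- The normalised vector `w / ‖w‖`. -/
def normalized {d : ℕ} (w : Vec d) : Vec d := ‖w‖⁻¹ • w

/-- The number `⌈2 d log (1/δ)⌉` of random directions drawn in one greedy step. -/
def numDirections (d : ℕ) (δ : ℝ) : ℕ := ⌈2 * (d : ℝ) * Real.log (1 / δ)⌉₊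

/-- `(u, v)` is a pair of `τ`-approximate leading singular vectors of the bilinear form `B`:
`B u v ≥ (1 - τ) * max B u' v'` over unit vectors `u'`, `v'`. -/
def IsApproxSingularPair {d : ℕ} (τ : ℝ) (B : Vec d → Vec d → ℝ) (u v : Vec d) : Prop :=
  ‖u‖ = 1 ∧ ‖v‖ = 1 ∧ ∀ u' v' : Vec d, ‖u'‖ = 1 → ‖v'‖ = 1 → (1 - τ) * B u' v' ≤ B u v

/-- `(w, u, v)` is a possible output of approximate tensor maximization of the trilinear form `F`
with the drawn directions `W 0, …, W (s - 1)`: each direction is normalised, a pair of approximate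
leading singular vectors `(u_i, v_i)` of the matrix of `F (w_i, ·, ·)` is computed, and the triple
`(w_i, u_i, v_i)` with the largest value of `F` is returned. -/
def IsTensorMaxOutput {d s : ℕ} (τ : ℝ) (F : Vec d → Vec d → Vec d → ℝ) (W : Fin s → Vec d)
    (w u v : Vec d) : Prop :=
  ∃ us vs : Fin s → Vec d,
    (∀ i, IsApproxSingularPair τ (F (normalized (W i))) (us i) (vs i)) ∧
    ∃ j, (∀ i, F (normalized (W i)) (us i) (vs i) ≤ F (normalized (W j)) (us j) (vs j)) ∧
      w = normalized (W j) ∧ u = us j ∧ v = vs j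

/-- `g` is a possible choice of the greedy step at the function `f` with drawn directions `W`.
One candidate is computed in each of `V_1`, `V_2`, `V_3`: a `τ`-approximately best linear form, a
product of two linear forms given by `τ`-approximate leading singular vectors, and the output of
approximate tensor maximization. The best of the three candidates is selected. -/
def IsGreedyChoice {d m s : ℕ} (τ : ℝ) (l : ℝ → ℝ → ℝ) (x : Fin m → Vec d) (y : Fin m → ℝ)
    (W : Fin s → Vec d) (f g : Vec d → ℝ) : Prop :=
  ∃ a b c w u v : Vec d,
    (‖a‖ = 1 ∧ ∀ a' : Vec d, ‖a'‖ = 1 →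
      (1 - τ) * riskSlope l x y f (linProd ![a']) ≤ riskSlope l x y f (linProd ![a])) ∧
    IsApproxSingularPair τ (fun b' c' => riskSlope l x y f (linProd ![b', c'])) b c ∧
    IsTensorMaxOutput τ (fun w' u' v' => riskSlope l x y f (linProd ![w', u', v'])) W w u v ∧
    (g = linProd ![a] ∨ g = linProd ![b, c] ∨ g = linProd ![w, u, v]) ∧
    riskSlope l x y f (linProd ![a]) ≤ riskSlope l x y f g ∧
    riskSlope l x y f (linProd ![b, c]) ≤ riskSlope l x y f g ∧
    riskSlope l x y f (linProd ![w, u, v]) ≤ riskSlope l x y f g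

/-- `f'` minimizes the empirical risk over the linear combinations of `g 0, …, g t`. -/
def IsRefit {d m : ℕ} (l : ℝ → ℝ → ℝ) (x : Fin m → Vec d) (y : Fin m → ℝ)
    (g : ℕ → Vec d → ℝ) (t : ℕ) (f' : Vec d → ℝ) : Prop :=
  f' ∈ Submodule.span ℝ {h | ∃ j ≤ t, h = g j} ∧
    ∀ h ∈ Submodule.span ℝ {h | ∃ j ≤ t, h = g j}, risk l x y f' ≤ risk l x y h

/-- `r` iterations of the GECO algorithm on the sample `(x, y)` with parameters `τ`, `δ`, on the
probability space `(Ω, μ)`. `W t` is the family of directions drawn in iteration `t`, `g t` is the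
unit added in iteration `t`, and `f t` is the predictor held after `t` iterations. `ℱ t` is the
information available after `t` iterations. -/
structure IsGecoRun {d m : ℕ} {Ω : Type*} [MeasurableSpace Ω] (μ : Measure Ω)
    (ℱ : Filtration ℕ (‹MeasurableSpace Ω› : MeasurableSpace Ω)) (τ δ : ℝ) (l : ℝ → ℝ → ℝ)
    (x : Fin m → Vec d) (y : Fin m → ℝ) (r : ℕ)
    (W : ℕ → Ω → Fin (numDirections d δ) → Vec d)
    (g f : ℕ → Ω → Vec d → ℝ) : Prop where
  /-- The directions of one iteration are drawn i.i.d. from the standard Gaussian on `ℝ^d`. -/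
  law : ∀ t < r, μ.map (W t) = Measure.pi (fun _ => stdGaussian (Vec d))
  /-- They are drawn freshly, independently of everything that happened before. -/
  fresh : ∀ t < r, Indep (ℱ t) (MeasurableSpace.comap (W t) inferInstance) μ
  /-- After the iteration they are part of the history. -/
  drawn : ∀ t < r, Measurable[ℱ (t + 1)] (W t)
  /-- The current predictor is determined by the history. -/
  adapted : ∀ t ≤ r, ∀ z : Vec d, Measurable[ℱ t] (fun ω => f t ω z)
  /-- The algorithm starts with the zero predictor. -/
  init : ∀ᵐ ω ∂μ, f 0 ω = 0
  /-- Greedy step. -/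
  greedy : ∀ t < r, ∀ᵐ ω ∂μ, IsGreedyChoice τ l x y (W t ω) (f t ω) (g t ω)
  /-- All output weights are refitted. -/
  refit : ∀ t < r, ∀ᵐ ω ∂μ, IsRefit l x y (fun j => g j ω) t (f (t + 1) ω)

end PolyNet

end

noncomputable section

namespace PolyNet

/-! ### Normalised Gaussian directions -/

/-! The proof combines a probabilistic estimate for one greedy step with a deterministic rate.
Randomness: by rotation invariance a normalised Gaussian `w` satisfies `E ⟪w, e⟫ ^ 2 = 1 / d` for
every unit `e`. As the square is at most `1`, it exceeds `1 / (2 d)` with probability at least `1 /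
(2 d)`, so `⌈2 d log (1/δ)⌉` draws all fail with probability at most `δ`. With the optimal second
and third arguments fixed, a trilinear form is linear in the first, so one aligned direction
recovers the maximum up to `√(2 d)` (`le_pi_goodDraws`). This holds for every fixed form and the
draws are independent of the past, so all `r` steps succeed with probability at least `(1 - δ) ^ r`
(`pow_le_measureReal_forall_mem`). Rate: refitting makes the slope of the risk at `f` along `f`
vanish. Convexity then bounds the excess risk by `√(2 d) k / (1 - τ)` times the greedy slope
(`IsGreedyChoice.mul_excess_le`), while smoothness turns a slope into a decrease of the risk. The
excess obeys `Δ' ≤ Δ - Δ ^ 2 / C` with `C = 4 d β k ^ 2 / (1 - τ) ^ 2`, hence is at most `C / r`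
(`nat_mul_excess_le`). Network size: products are differences of squares, `p q = ((p + q) ^ 2 - (p -
q) ^ 2) / 4`, and two layers of squares express any sum of hidden units. -/

lemma measurable_normalized {d : ℕ} : Measurable (normalized (d := d)) := by
  unfold normalized
  fun_prop

lemma normalized_map {d : ℕ} (f : Vec d ≃ₗᵢ[ℝ] Vec d) (w : Vec d) :
    normalized (f w) = f (normalized w) := by
  simp [normalized]

lemma norm_normalized_le {d : ℕ} (w : Vec d) : ‖normalized w‖ ≤ 1 := by
  unfold normalized
  rw [norm_smul, norm_inv, norm_norm]
  exact inv_mul_le_one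

lemma norm_normalized {d : ℕ} {w : Vec d} (hw : w ≠ 0) : ‖normalized w‖ = 1 := by
  unfold normalized
  rw [norm_smul, norm_inv, norm_norm]
  exact inv_mul_cancel₀ (norm_ne_zero_iff.2 hw)

lemma sq_inner_normalized_le {d : ℕ} {e : Vec d} (he : ‖e‖ = 1) (w : Vec d) :
    ⟪normalized w, e⟫ ^ 2 ≤ 1 := by
  rw [sq_le_one_iff_abs_le_one]
  calc |⟪normalized w, e⟫| ≤ ‖normalized w‖ * ‖e‖ := abs_real_inner_le_norm _ _
    _ ≤ 1 := by rw [he, mul_one]; exact norm_normalized_le w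

lemma integrable_sq_inner_normalized {d : ℕ} {e : Vec d} (he : ‖e‖ = 1) :
    Integrable (fun w => ⟪normalized w, e⟫ ^ 2) (stdGaussian (Vec d)) := by
  refine Integrable.of_bound (C := 1) ?_ (Filter.Eventually.of_forall fun w => ?_)
  · have := measurable_normalized (d := d)
    exact (by fun_prop : Measurable fun w : Vec d => ⟪normalized w, e⟫ ^ 2).aestronglyMeasurable
  · rw [Real.norm_eq_abs, abs_of_nonneg (sq_nonneg _)]
    exact sq_inner_normalized_le he w

/-- Needed because `normalized 0 = 0` is not a unit vector. -/
lemma stdGaussian_ae_ne_zero {d : ℕ} (hd : 0 < d) : ∀ᵐ w ∂(stdGaussian (Vec d)), w ≠ 0 := by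
  rw [← map_pi_eq_stdGaussian, ae_map_iff (by fun_prop) (by measurability)]
  have h : ∀ᵐ w : Fin d → ℝ ∂(Measure.pi fun _ => gaussianReal 0 1), w ⟨0, hd⟩ ≠ 0 := by
    have hna : NullSingletonClass (gaussianReal 0 1) :=
      nullSingletonClass_gaussianReal one_ne_zero
    refine (measurePreserving_eval (fun _ : Fin d => gaussianReal 0 1)
      ⟨0, hd⟩).quasiMeasurePreserving.ae (p := fun z : ℝ => z ≠ 0) ?_
    simp [ae_iff]
  filter_upwards [h] with w hw h0
  apply hw
  have := congrArg (fun v : Vec d => v ⟨0, hd⟩) h0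
  simpa using this

/-- The reflection in the hyperplane orthogonal to `e - e'` sends `e` to `e'` and preserves the
Gaussian. -/
lemma integral_sq_inner_normalized_congr {d : ℕ} {e e' : Vec d} (he : ‖e‖ = ‖e'‖) :
    ∫ w, ⟪normalized w, e⟫ ^ 2 ∂(stdGaussian (Vec d)) =
      ∫ w, ⟪normalized w, e'⟫ ^ 2 ∂(stdGaussian (Vec d)) := by
  set ρ := Submodule.reflection (ℝ ∙ (e - e'))ᗮ
  have hρ : ρ e = e' := Submodule.reflection_sub he
  have hm := measurable_normalized (d := d)
  conv_rhs => rw [← stdGaussian_map ρ]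
  rw [integral_map (by fun_prop)
    (by exact (by fun_prop : Measurable fun w : Vec d =>
      ⟪normalized w, e'⟫ ^ 2).aestronglyMeasurable)]
  refine integral_congr_ae (Filter.Eventually.of_forall fun w => ?_)
  simp only
  rw [normalized_map, ← hρ, LinearIsometryEquiv.inner_map_map]

/-- The squared coordinates of a unit vector sum to `1`, and by symmetry all `d` of them have the
same mean. -/
lemma integral_sq_inner_normalized {d : ℕ} (hd : 0 < d) {e : Vec d} (he : ‖e‖ = 1) :
    ∫ w, ⟪normalized w, e⟫ ^ 2 ∂(stdGaussian (Vec d)) = 1 / d := by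
  set b := EuclideanSpace.basisFun (Fin d) ℝ
  have hb : ∀ i, ∫ w, ⟪normalized w, b i⟫ ^ 2 ∂(stdGaussian (Vec d)) =
      ∫ w, ⟪normalized w, e⟫ ^ 2 ∂(stdGaussian (Vec d)) := fun i =>
    integral_sq_inner_normalized_congr (by rw [he]; exact b.orthonormal.1 i)
  have hs : ∑ i, ∫ w, ⟪normalized w, b i⟫ ^ 2 ∂(stdGaussian (Vec d)) = 1 := by
    rw [← integral_finsetSum _ fun i _ => integrable_sq_inner_normalized (b.orthonormal.1 i)]
    have : (fun w : Vec d => ∑ i, ⟪normalized w, b i⟫ ^ 2) =ᵐ[stdGaussian (Vec d)]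
        fun _ => (1 : ℝ) := by
      filter_upwards [stdGaussian_ae_ne_zero hd] with w hw
      rw [b.sum_sq_inner_left, norm_normalized hw, one_pow]
    rw [integral_congr_ae this]
    simp
  simp only [hb, Finset.sum_const, Finset.card_univ, Fintype.card_fin, nsmul_eq_mul] at hs
  have : (d : ℝ) ≠ 0 := by positivity
  field_simp
  linarith

/-- The directions that are not nearly orthogonal to `e`. -/
def alignedSet {d : ℕ} (e : Vec d) : Set (Vec d) :=
  {w | 1 / (2 * d : ℝ) ≤ ⟪normalized w, e⟫ ^ 2}

lemma measurableSet_alignedSet {d : ℕ} (e : Vec d) : MeasurableSet (alignedSet e) := by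
  have hm := measurable_normalized (d := d)
  exact measurableSet_le measurable_const (by fun_prop)

/-- Integrate the pointwise bound of the square by the indicator of the aligned set plus `1 / (2
d)`; the left side has mean `1 / d`. -/
lemma le_stdGaussian_alignedSet {d : ℕ} (hd : 0 < d) {e : Vec d} (he : ‖e‖ = 1) :
    1 / (2 * d : ℝ) ≤ (stdGaussian (Vec d)).real (alignedSet e) := by
  have hA := measurableSet_alignedSet e
  have h : ∫ w, ⟪normalized w, e⟫ ^ 2 ∂(stdGaussian (Vec d)) ≤
      ∫ w, ((alignedSet e).indicator (fun _ => (1 : ℝ)) w + 1 / (2 * d : ℝ))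
        ∂(stdGaussian (Vec d)) := by
    refine integral_mono (integrable_sq_inner_normalized he)
      (((integrable_const _).indicator hA).add (integrable_const _)) fun w => ?_
    by_cases hw : w ∈ alignedSet e
    · simp only [Set.indicator_of_mem hw]
      have := sq_inner_normalized_le he w
      have : 0 ≤ 1 / (2 * d : ℝ) := by positivity
      linarith
    · simp only [Set.indicator_of_notMem hw, zero_add]
      exact (not_le.1 hw).le
  rw [integral_sq_inner_normalized hd he, integral_add ((integrable_const _).indicator hA)
    (integrable_const _), integral_indicator_const _ hA] at h
  simp only [smul_eq_mul, mul_one, integral_const, probReal_univ, one_mul] at h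
  have : (1 : ℝ) / d = 1 / (2 * d) + 1 / (2 * d) := by
    have : (d : ℝ) ≠ 0 := by positivity
    field_simp
    norm_num
  linarith

lemma le_pi_exists_mem {α : Type*} [MeasurableSpace α] (ν : Measure α) [IsProbabilityMeasure ν]
    {A : Set α} (hA : MeasurableSet A) {s : ℕ} {δ p : ℝ} (hδ : 0 < δ)
    (hp : p ≤ ν.real A) (hs : Real.log (1 / δ) ≤ s * p) :
    1 - δ ≤ (Measure.pi fun _ : Fin s => ν).real {W | ∃ i, W i ∈ A} := by
  have hc : {W : Fin s → α | ∃ i, W i ∈ A} = (Set.univ.pi fun _ => Aᶜ)ᶜ := by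
    ext W
    simp [Set.mem_pi]
  rw [hc, probReal_compl_eq_one_sub (MeasurableSet.univ_pi fun _ => hA.compl), measureReal_def,
    Measure.pi_pi, Finset.prod_const, Finset.card_univ, Fintype.card_fin, ENNReal.toReal_pow,
    ← measureReal_def, probReal_compl_eq_one_sub hA]
  have h0 : 0 ≤ 1 - ν.real A := sub_nonneg.2 measureReal_le_one
  have h1 : 1 - ν.real A ≤ Real.exp (-p) := by
    have := Real.add_one_le_exp (-p)
    linarith
  have h2 : (1 - ν.real A) ^ s ≤ δ :=
    calc (1 - ν.real A) ^ s ≤ Real.exp (-p) ^ s := pow_le_pow_left₀ h0 h1 s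
      _ = Real.exp (-(s * p)) := by rw [← Real.exp_nat_mul]; ring_nf
      _ ≤ Real.exp (Real.log δ) := by
        rw [one_div, Real.log_inv] at hs
        exact Real.exp_le_exp.2 (by linarith)
      _ = δ := Real.exp_log hδ
  linarith

lemma le_pi_exists_aligned {d : ℕ} (hd : 0 < d) {δ : ℝ} (hδ : 0 < δ) {e : Vec d} (he : ‖e‖ = 1) :
    1 - δ ≤ (Measure.pi fun _ : Fin (numDirections d δ) => stdGaussian (Vec d)).real
      {W | ∃ i, W i ∈ alignedSet e} := by
  refine le_pi_exists_mem _ (measurableSet_alignedSet e) hδ (le_stdGaussian_alignedSet hd he) ?_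
  have h := Nat.le_ceil (2 * (d : ℝ) * Real.log (1 / δ))
  have hd' : (0 : ℝ) < 2 * d := by positivity
  rw [mul_one_div, le_div_iff₀ hd', mul_comm]
  exact h

/-! ### Random directions approximately maximize a trilinear form -/

lemma linProd_one {d : ℕ} (a y : Vec d) : linProd ![a] y = ⟪a, y⟫ := by
  simp [linProd]

lemma linProd_three {d : ℕ} (a b c y : Vec d) :
    linProd ![a, b, c] y = ⟪a, y⟫ * ⟪b, y⟫ * ⟪c, y⟫ := by
  simp [linProd, Fin.prod_univ_three]

/-- The weighted mean of the values of `g` on the sample. -/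
def weightedMean {d m : ℕ} (x : Fin m → Vec d) (c : Fin m → ℝ) (g : Vec d → ℝ) : ℝ :=
  (1 / (m : ℝ)) * ∑ i, c i * g (x i)

lemma exists_norm_eq_one {d : ℕ} (hd : 0 < d) : ∃ e : Vec d, ‖e‖ = 1 :=
  ⟨EuclideanSpace.single ⟨0, hd⟩ 1, by simp⟩

lemma exists_weightedMean_linProd_eq_inner {d m : ℕ} (x : Fin m → Vec d) (c : Fin m → ℝ)
    (u v : Vec d) : ∃ p : Vec d, ∀ w, weightedMean x c (linProd ![w, u, v]) = ⟪w, p⟫ := by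
  refine ⟨(1 / (m : ℝ)) • ∑ i, (c i * ⟪u, x i⟫ * ⟪v, x i⟫) • x i, fun w => ?_⟩
  simp only [weightedMean, linProd_three, inner_smul_right, inner_sum]
  congr 1
  exact Finset.sum_congr rfl fun i _ => by ring

lemma weightedMean_linProd_neg {d m : ℕ} (x : Fin m → Vec d) (c : Fin m → ℝ)
    (w u v : Vec d) :
    weightedMean x c (linProd ![w, -u, v]) = -weightedMean x c (linProd ![w, u, v]) := by
  simp [weightedMean, linProd_three]

lemma continuous_weightedMean_linProd {d m : ℕ} (x : Fin m → Vec d) :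
    Continuous fun p : (Fin m → ℝ) × Vec d × Vec d × Vec d =>
      weightedMean x p.1 (linProd ![p.2.1, p.2.2.1, p.2.2.2]) := by
  simp only [weightedMean, linProd_three]
  fun_prop

/-- The pairs of weights and directions `w` such that some trilinear value with first argument `w`
is at least the maximum divided by `√(2 d)`. -/
def nearOptimalDirections {d m : ℕ} (x : Fin m → Vec d) : Set ((Fin m → ℝ) × Vec d) :=
  {p | ∃ u v : Vec d, ‖u‖ = 1 ∧ ‖v‖ = 1 ∧ ∀ w' u' v' : Vec d, ‖w'‖ = 1 → ‖u'‖ = 1 → ‖v'‖ = 1 →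
    weightedMean x p.1 (linProd ![w', u', v']) ≤
      √(2 * d) * weightedMean x p.1 (linProd ![p.2, u, v])}

/-- The existential quantifier ranges over a compact product of spheres, and projecting a closed set
along a compact factor gives a closed set. This makes the good event measurable although the
algorithm's own choices of singular vectors need not be. -/
lemma isClosed_nearOptimalDirections {d m : ℕ} (x : Fin m → Vec d) :
    IsClosed (nearOptimalDirections x) := by
  let S := Metric.sphere (0 : Vec d) 1
  let T : Set ((S × S) × ((Fin m → ℝ) × Vec d)) :=
    {q | ∀ w' u' v' : Vec d, ‖w'‖ = 1 → ‖u'‖ = 1 → ‖v'‖ = 1 →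
      weightedMean x q.2.1 (linProd ![w', u', v']) ≤
        √(2 * d) * weightedMean x q.2.1 (linProd ![q.2.2, (q.1.1 : Vec d), (q.1.2 : Vec d)])}
  have hT : IsClosed T := by
    simp only [T, Set.ofPred_forall]
    refine isClosed_iInter fun w' => isClosed_iInter fun u' => isClosed_iInter fun v' =>
      isClosed_iInter fun _ => isClosed_iInter fun _ => isClosed_iInter fun _ => ?_
    have h := continuous_weightedMean_linProd x
    refine isClosed_le (h.comp (g := fun p : (Fin m → ℝ) × Vec d × Vec d × Vec d =>
      weightedMean x p.1 (linProd ![p.2.1, p.2.2.1, p.2.2.2]))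
      (f := fun q : (S × S) × ((Fin m → ℝ) × Vec d) => (q.2.1, w', u', v')) (by fun_prop))
      (continuous_const.mul (h.comp (f := fun q : (S × S) × ((Fin m → ℝ) × Vec d) =>
        (q.2.1, q.2.2, (q.1.1 : Vec d), (q.1.2 : Vec d))) (by fun_prop)))
  have himg : nearOptimalDirections x = Prod.snd '' T := by
    ext p
    constructor
    · rintro ⟨u, v, hu, hv, h⟩
      exact ⟨((⟨u, by simp [S, hu]⟩, ⟨v, by simp [S, hv]⟩), p), h, rfl⟩
    · rintro ⟨⟨⟨u, v⟩, p⟩, h, rfl⟩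
      exact ⟨u, v, mem_sphere_zero_iff_norm.1 u.2, mem_sphere_zero_iff_norm.1 v.2, h⟩
  rw [himg]
  exact isClosedMap_snd_of_compactSpace T hT

lemma exists_forall_weightedMean_le {d m : ℕ} (hd : 0 < d) (x : Fin m → Vec d) (c : Fin m → ℝ) :
    ∃ w u v : Vec d, ‖w‖ = 1 ∧ ‖u‖ = 1 ∧ ‖v‖ = 1 ∧
      ∀ w' u' v' : Vec d, ‖w'‖ = 1 → ‖u'‖ = 1 → ‖v'‖ = 1 →
        weightedMean x c (linProd ![w', u', v']) ≤ weightedMean x c (linProd ![w, u, v]) := by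
  obtain ⟨e, he⟩ := exists_norm_eq_one hd
  have hS : IsCompact (Metric.sphere (0 : Vec d) 1) := isCompact_sphere _ _
  have heS : e ∈ Metric.sphere (0 : Vec d) 1 := by simpa using he
  have hcont : Continuous fun p : Vec d × Vec d × Vec d =>
      weightedMean x c (linProd ![p.1, p.2.1, p.2.2]) := by
    simp only [weightedMean, linProd_three]
    fun_prop
  obtain ⟨p, hp, h⟩ := (hS.prod (hS.prod hS)).exists_isMaxOn
    ⟨(e, e, e), Set.mk_mem_prod heS (Set.mk_mem_prod heS heS)⟩ hcont.continuousOn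
  rw [Set.mem_prod, Set.mem_prod] at hp
  refine ⟨p.1, p.2.1, p.2.2, mem_sphere_zero_iff_norm.1 hp.1, mem_sphere_zero_iff_norm.1 hp.2.1,
    mem_sphere_zero_iff_norm.1 hp.2.2, fun w' u' v' hw' hu' hv' => ?_⟩
  exact isMaxOn_iff.1 h (w', u', v') (Set.mk_mem_prod (mem_sphere_zero_iff_norm.2 hw')
    (Set.mk_mem_prod (mem_sphere_zero_iff_norm.2 hu') (mem_sphere_zero_iff_norm.2 hv')))

/-- At a maximizer `(w₀, u, v)` the form is `⟪·, p⟫` in its first argument, so the maximum is at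
most `‖p‖`; take `e` in the direction of `p`. A wrong sign of `⟪w, p⟫` is repaired by replacing `u`
with `-u`. -/
lemma exists_aligned_subset_nearOptimalDirections {d m : ℕ} (hd : 0 < d) (x : Fin m → Vec d)
    (c : Fin m → ℝ) :
    ∃ e : Vec d, ‖e‖ = 1 ∧ ∀ w ∈ alignedSet e, (c, normalized w) ∈ nearOptimalDirections x := by
  obtain ⟨w₀, u, v, hw₀, hu, hv, hmax⟩ := exists_forall_weightedMean_le hd x c
  obtain ⟨p, hp⟩ := exists_weightedMean_linProd_eq_inner x c u v
  obtain ⟨e, he, hpe⟩ : ∃ e : Vec d, ‖e‖ = 1 ∧ p = ‖p‖ • e := by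
    by_cases h0 : p = 0
    · obtain ⟨e, he⟩ := exists_norm_eq_one hd
      exact ⟨e, he, by simp [h0]⟩
    · refine ⟨normalized p, norm_normalized h0, ?_⟩
      rw [normalized, smul_smul, mul_inv_cancel₀ (norm_ne_zero_iff.2 h0), one_smul]
  refine ⟨e, he, fun w hw => ?_⟩
  have hle : ∀ w' u' v' : Vec d, ‖w'‖ = 1 → ‖u'‖ = 1 → ‖v'‖ = 1 →
      weightedMean x c (linProd ![w', u', v']) ≤
        √(2 * d) * |weightedMean x c (linProd ![normalized w, u, v])| := by
    intro w' u' v' hw' hu' hv'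
    have h1 : weightedMean x c (linProd ![w₀, u, v]) ≤ ‖p‖ := by
      rw [hp]
      simpa [hw₀] using real_inner_le_norm w₀ p
    have h2 : |weightedMean x c (linProd ![normalized w, u, v])| =
        ‖p‖ * |⟪normalized w, e⟫| := by
      rw [hp]
      conv_lhs => rw [hpe]
      rw [inner_smul_right, abs_mul, abs_norm]
    have h3 : 1 ≤ √(2 * d) * |⟪normalized w, e⟫| := by
      rw [← Real.sqrt_sq_eq_abs, ← Real.sqrt_mul (by positivity), Real.one_le_sqrt]
      have hw' : 1 / (2 * d : ℝ) ≤ ⟪normalized w, e⟫ ^ 2 := hw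
      have hd' : (0 : ℝ) < 2 * d := by positivity
      rwa [div_le_iff₀' hd'] at hw'
    rw [h2]
    calc _ ≤ ‖p‖ := (hmax w' u' v' hw' hu' hv').trans h1
      _ ≤ ‖p‖ * (√(2 * d) * |⟪normalized w, e⟫|) := le_mul_of_one_le_right (norm_nonneg _) h3
      _ = _ := by ring
  rcases abs_choice (weightedMean x c (linProd ![normalized w, u, v])) with h | h
  · exact ⟨u, v, hu, hv, by rwa [h] at hle⟩
  · refine ⟨-u, v, by rwa [norm_neg], hv, ?_⟩
    simp only [weightedMean_linProd_neg]
    rwa [h] at hle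

/-- The pairs of weights and drawn directions for which one of the directions is nearly optimal. -/
def goodDraws {d m : ℕ} (s : ℕ) (x : Fin m → Vec d) : Set ((Fin m → ℝ) × (Fin s → Vec d)) :=
  {p | ∃ i, (p.1, normalized (p.2 i)) ∈ nearOptimalDirections x}

lemma measurableSet_goodDraws {d m : ℕ} (s : ℕ) (x : Fin m → Vec d) :
    MeasurableSet (goodDraws s x) := by
  have hm := measurable_normalized (d := d)
  simp only [goodDraws, Set.ofPred_exists]
  refine MeasurableSet.iUnion fun i => ?_
  exact (by fun_prop : Measurable fun p : (Fin m → ℝ) × (Fin s → Vec d) =>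
    (p.1, normalized (p.2 i))) (isClosed_nearOptimalDirections x).measurableSet

/-- The bound is uniform in the weights `c`, so it can be applied conditionally on the history that
determines them. -/
lemma le_pi_goodDraws {d m : ℕ} (hd : 0 < d) {δ : ℝ} (hδ : 0 < δ) (x : Fin m → Vec d)
    (c : Fin m → ℝ) :
    1 - δ ≤ (Measure.pi fun _ : Fin (numDirections d δ) => stdGaussian (Vec d)).real
      {W | (c, W) ∈ goodDraws (numDirections d δ) x} := by
  obtain ⟨e, he, h⟩ := exists_aligned_subset_nearOptimalDirections hd x c
  refine (le_pi_exists_aligned hd hδ he).trans (measureReal_mono ?_)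
  rintro W ⟨i, hi⟩
  exact ⟨i, h _ hi⟩

/-! ### Chaining fresh random draws -/

/-- If `X` is part of the information `𝒢`, and `Y` is independent of it, then an event that has
probability at least `p` under the law of `Y` for every value of `X` has conditional probability
at least `p` given any event of `𝒢`. -/
lemma mul_le_measureReal_inter {Ω α γ : Type*} {𝒢 mΩ : MeasurableSpace Ω} [MeasurableSpace α]
    [MeasurableSpace γ] {μ : Measure Ω} [IsProbabilityMeasure μ]
    (h𝒢 : 𝒢 ≤ mΩ) {X : Ω → α} {Y : Ω → γ} (hX : Measurable[𝒢] X) (hY : Measurable Y)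
    {ν : Measure γ} [IsProbabilityMeasure ν] (hlaw : μ.map Y = ν)
    (hind : Indep 𝒢 (MeasurableSpace.comap Y inferInstance) μ)
    {S : Set (α × γ)} (hS : MeasurableSet S) {p : ℝ}
    (hp : ∀ a, p ≤ ν.real {b | (a, b) ∈ S}) {A : Set Ω} (hA : MeasurableSet[𝒢] A) :
    p * μ.real A ≤ μ.real (A ∩ {ω | (X ω, Y ω) ∈ S}) := by
  have hX' : Measurable X := hX.mono h𝒢 le_rfl
  have hA' : MeasurableSet A := h𝒢 A hA
  -- Recording membership in `A` together with `X` gives one variable independent of `Y`, so Fubini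
  -- handles both at once.
  have hAX : Measurable[𝒢] fun ω => (ω ∈ A, X ω) :=
    ((@measurableSet_setOfPred _ 𝒢 _).1 hA).prodMk hX
  have hAX' : Measurable fun ω => (ω ∈ A, X ω) := hAX.mono h𝒢 le_rfl
  have hindep : IndepFun (fun ω => (ω ∈ A, X ω)) Y μ := by
    rw [IndepFun_iff_Indep]
    exact indep_of_indep_of_le_left hind hAX.comap_le
  have hmap := (indepFun_iff_map_prod_eq_prod_map_map hAX'.aemeasurable hY.aemeasurable).1 hindep
  rw [hlaw] at hmap
  set S' : Set ((Prop × α) × γ) := {q | q.1.1 ∧ (q.1.2, q.2) ∈ S}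
  have hS' : MeasurableSet S' :=
    (measurableSet_setOfPred.2 (by fun_prop)).inter
      ((by fun_prop : Measurable fun q : (Prop × α) × γ => (q.1.2, q.2)) hS)
  have hpre : A ∩ {ω | (X ω, Y ω) ∈ S} = (fun ω => ((ω ∈ A, X ω), Y ω)) ⁻¹' S' := rfl
  have hmeas : μ (A ∩ {ω | (X ω, Y ω) ∈ S}) =
      ∫⁻ ω, ν (Prod.mk (ω ∈ A, X ω) ⁻¹' S') ∂μ := by
    rw [hpre, ← Measure.map_apply (hAX'.prodMk hY) hS', hmap, Measure.prod_apply hS',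
      lintegral_map (measurable_measure_prodMk_left hS') hAX']
  have hle : ENNReal.ofReal p * μ A ≤ μ (A ∩ {ω | (X ω, Y ω) ∈ S}) := by
    rw [hmeas, ← lintegral_indicator_const hA']
    refine lintegral_mono fun ω => ?_
    by_cases hω : ω ∈ A
    · rw [Set.indicator_of_mem hω]
      have : Prod.mk (ω ∈ A, X ω) ⁻¹' S' = {b | (X ω, b) ∈ S} := by
        ext b
        simp [S', hω]
      rw [this]
      exact ENNReal.ofReal_le_of_le_toReal (hp (X ω))
    · rw [Set.indicator_of_notMem hω]
      exact zero_le
  rcases le_or_gt p 0 with h0 | h0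
  · exact (mul_nonpos_of_nonpos_of_nonneg h0 measureReal_nonneg).trans measureReal_nonneg
  · have := ENNReal.toReal_mono (measure_ne_top _ _) hle
    rwa [ENNReal.toReal_mul, ENNReal.toReal_ofReal h0.le] at this

lemma pow_le_measureReal_forall_mem {Ω α γ : Type*} {mΩ : MeasurableSpace Ω} [MeasurableSpace α]
    [MeasurableSpace γ] {μ : Measure Ω} [IsProbabilityMeasure μ] (ℱ : Filtration ℕ mΩ)
    {r : ℕ} {X : ℕ → Ω → α} {Y : ℕ → Ω → γ} {ν : Measure γ} [IsProbabilityMeasure ν]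
    (hX : ∀ t < r, Measurable[ℱ t] (X t)) (hY : ∀ t < r, Measurable[ℱ (t + 1)] (Y t))
    (hlaw : ∀ t < r, μ.map (Y t) = ν)
    (hind : ∀ t < r, Indep (ℱ t) (MeasurableSpace.comap (Y t) inferInstance) μ)
    {S : Set (α × γ)} (hS : MeasurableSet S) {p : ℝ} (hp0 : 0 ≤ p)
    (hp : ∀ a, p ≤ ν.real {b | (a, b) ∈ S}) :
    p ^ r ≤ μ.real {ω | ∀ t < r, (X t ω, Y t ω) ∈ S} := by
  -- Measurability with respect to `ℱ n` is carried along because the next draw is independent only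
  -- of events in `ℱ n`.
  suffices h : ∀ n ≤ r, MeasurableSet[ℱ n] {ω | ∀ t < n, (X t ω, Y t ω) ∈ S} ∧
      p ^ n ≤ μ.real {ω | ∀ t < n, (X t ω, Y t ω) ∈ S} from (h r le_rfl).2
  intro n
  induction n with
  | zero => simp
  | succ n ih =>
    intro hn
    obtain ⟨hm, hle⟩ := ih (by omega)
    have hset : {ω | ∀ t < n + 1, (X t ω, Y t ω) ∈ S} =
        {ω | ∀ t < n, (X t ω, Y t ω) ∈ S} ∩ {ω | (X n ω, Y n ω) ∈ S} := by
      ext ω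
      simp only [Set.mem_ofPred_eq, Set.mem_inter_iff, Nat.forall_lt_succ_right]
    rw [hset]
    refine ⟨(ℱ.mono n.le_succ _ hm).inter
      ((((hX n hn).mono (ℱ.mono n.le_succ) le_rfl).prodMk (hY n hn)) hS), ?_⟩
    calc p ^ (n + 1) = p * p ^ n := pow_succ' p n
      _ ≤ p * _ := mul_le_mul_of_nonneg_left hle hp0
      _ ≤ _ := mul_le_measureReal_inter (ℱ.le n) (hX n hn)
        ((hY n hn).mono (ℱ.le _) le_rfl) (hlaw n hn) (hind n hn) hS hp hm

/-! ### Linear combinations of hidden units are networks with two hidden layers -/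

lemma exists_eq_inner_mul_of_mem_hiddenUnits {d : ℕ} {g : Vec d → ℝ} (hg : g ∈ hiddenUnits d) :
    ∃ (w u v c : Vec d) (b : ℝ), ∀ z, g z = ⟪w, z⟫ * (⟪u, z⟫ * ⟪v, z⟫ + ⟪c, z⟫ + b) := by
  rcases hg with (⟨w, -, rfl⟩ | ⟨w, -, rfl⟩) | ⟨w, -, rfl⟩
  · exact ⟨w 0, 0, 0, 0, 1, fun z => by simp [linProd]⟩
  · exact ⟨w 0, 0, 0, w 1, 0, fun z => by simp [linProd, Fin.prod_univ_two]⟩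
  · exact ⟨w 0, w 1, w 2, 0, 0, fun z => by simp [linProd, Fin.prod_univ_three, mul_assoc]⟩

lemma sum_inner_mul_mem_networkClass {d r : ℕ} (hr : 0 < r) (a : Fin r → ℝ)
    (w u v c : Fin r → Vec d) (b : Fin r → ℝ) :
    (fun z => ∑ j, a j * (⟪w j, z⟫ * (⟪u j, z⟫ * ⟪v j, z⟫ + ⟪c j, z⟫ + b j))) ∈
      networkClass d 3 (5 * r) sqAct := by
  -- The last `r - 1` neurons are padding that outputs `0`: the count is `2 r + (r - 1) + 2 r + 1 =
  -- 5 r`.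
  have h₁ := HiddenLayers.input (σ := sqAct) (d := d) |>.layer (r + r + (r - 1))
    (fun _ _ => 0)
    (Fin.append (Fin.append (fun j => u j + v j) (fun j => u j - v j)) 0) 0
  -- With `q = ⟪u, z⟫ * ⟪v, z⟫ + ⟪c, z⟫ + b`, the two blocks compute `(⟪w, z⟫ + q) ^ 2` and `(⟪w, z⟫
  -- - q) ^ 2`.
  have h₂ := h₁.layer (r + r)
    (Fin.append
      (fun j => Fin.append (Fin.append (Pi.single j (1 / 4)) (Pi.single j (-1 / 4))) 0)
      (fun j => Fin.append (Fin.append (Pi.single j (-1 / 4)) (Pi.single j (1 / 4))) 0))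
    (Fin.append (fun j => w j + c j) (fun j => w j - c j))
    (Fin.append b (fun j => -b j))
  refine ⟨2, _, _, _, rfl, ?_, h₂, Fin.append (fun j => a j / 4) (fun j => -(a j / 4)), 0, 0, ?_⟩
  · omega
  · funext z
    simp only [Fin.sum_univ_add, Fin.append_left, Fin.append_right, Pi.single_apply, ite_mul,
      zero_mul, Finset.sum_ite_eq', Finset.sum_const_zero, Finset.univ_eq_empty,
      Finset.mem_univ, if_true, inner_add_left, inner_sub_left, inner_zero_left,
      Pi.zero_apply, add_zero, zero_add, sqAct]
    rw [← Finset.sum_add_distrib]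
    exact Finset.sum_congr rfl fun j _ => by ring

lemma exists_eq_sum_of_mem_span {d t : ℕ} {g : ℕ → Vec d → ℝ} {f : Vec d → ℝ}
    (hf : f ∈ Submodule.span ℝ {h | ∃ j ≤ t, h = g j}) :
    ∃ a : Fin (t + 1) → ℝ, f = fun z => ∑ j, a j * g j z := by
  have hset : {h | ∃ j ≤ t, h = g j} = Set.range fun j : Fin (t + 1) => g j := by
    ext h
    constructor
    · rintro ⟨j, hj, rfl⟩
      exact ⟨⟨j, by omega⟩, rfl⟩
    · rintro ⟨j, rfl⟩
      exact ⟨j, by omega, rfl⟩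
  rw [hset, Submodule.mem_span_range_iff_exists_fun] at hf
  obtain ⟨a, rfl⟩ := hf
  exact ⟨a, by funext z; simp⟩

lemma mem_networkClass_of_mem_span {d t : ℕ} {g : ℕ → Vec d → ℝ} {f : Vec d → ℝ}
    (hg : ∀ j ≤ t, g j ∈ hiddenUnits d)
    (hf : f ∈ Submodule.span ℝ {h | ∃ j ≤ t, h = g j}) :
    f ∈ networkClass d 3 (5 * (t + 1)) sqAct := by
  obtain ⟨a, rfl⟩ := exists_eq_sum_of_mem_span hf
  choose w u v c b h using fun j : Fin (t + 1) =>
    exists_eq_inner_mul_of_mem_hiddenUnits (hg j (by omega))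
  simp only [h]
  exact sum_inner_mul_mem_networkClass t.succ_pos a w u v c b

/-! ### The minimal risk is attained -/

/-- The values of `g` on the sample. -/
def sampleValues {d m : ℕ} (x : Fin m → Vec d) (g : Vec d → ℝ) : Fin m → ℝ := fun i => g (x i)

/-- The risk sees a function only through its sample values, so compactness is needed only for
those. -/
lemma isCompact_image_unitProducts {d m : ℕ} (x : Fin m → Vec d) (n : ℕ) :
    IsCompact (sampleValues x '' unitProducts d n) := by
  have h : sampleValues x '' unitProducts d n =
      (fun w : Fin n → Vec d => fun i => linProd w (x i)) ''
        Set.univ.pi fun _ => Metric.sphere (0 : Vec d) 1 := by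
    ext z
    constructor
    · rintro ⟨_, ⟨w, hw, rfl⟩, rfl⟩
      exact ⟨w, fun j _ => mem_sphere_zero_iff_norm.2 (hw j), rfl⟩
    · rintro ⟨w, hw, rfl⟩
      exact ⟨_, ⟨w, fun j => mem_sphere_zero_iff_norm.1 (hw j trivial), rfl⟩, rfl⟩
  rw [h]
  refine (isCompact_univ_pi fun _ => isCompact_sphere _ _).image ?_
  unfold linProd
  fun_prop

lemma isCompact_image_hiddenUnits {d m : ℕ} (x : Fin m → Vec d) :
    IsCompact (sampleValues x '' hiddenUnits d) := by
  simp only [hiddenUnits, Set.image_union]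
  exact ((isCompact_image_unitProducts x 1).union (isCompact_image_unitProducts x 2)).union
    (isCompact_image_unitProducts x 3)

lemma isCompact_image_cubicClass {d m : ℕ} (x : Fin m → Vec d) (k : ℕ) :
    IsCompact (sampleValues x '' cubicClass d k) := by
  have h : sampleValues x '' cubicClass d k =
      (fun p : (Fin k → ℝ) × (Fin k → Fin m → ℝ) => fun i => ∑ j, p.1 j * p.2 j i) ''
        ((Set.univ.pi fun _ => Set.Icc (-1 : ℝ) 1) ×ˢ
          Set.univ.pi fun _ => sampleValues x '' hiddenUnits d) := by
    ext z
    constructor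
    · rintro ⟨_, ⟨a, g, ha, hg, rfl⟩, rfl⟩
      exact ⟨(a, fun j => sampleValues x (g j)),
        ⟨fun j _ => abs_le.1 (ha j), fun j _ => ⟨g j, hg j, rfl⟩⟩, rfl⟩
    · rintro ⟨⟨a, Z⟩, ⟨ha, hZ⟩, rfl⟩
      choose g hg hgZ using fun j => hZ j trivial
      refine ⟨_, ⟨a, g, fun j => abs_le.2 (ha j trivial), hg, rfl⟩, ?_⟩
      funext i
      refine Finset.sum_congr rfl fun j _ => ?_
      rw [← congrFun (hgZ j) i]
      rfl
  rw [h]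
  exact ((isCompact_univ_pi fun _ => isCompact_Icc).prod
    (isCompact_univ_pi fun _ => isCompact_image_hiddenUnits x)).image (by fun_prop)

lemma hiddenUnits_nonempty {d : ℕ} (hd : 0 < d) : (hiddenUnits d).Nonempty := by
  obtain ⟨e, he⟩ := exists_norm_eq_one hd
  exact ⟨_, Or.inr ⟨fun _ => e, fun _ => he, rfl⟩⟩

lemma exists_isMinOn_risk {d m : ℕ} (hd : 0 < d) (k : ℕ) {l : ℝ → ℝ → ℝ}
    (hl : ∀ y, Continuous fun z => l z y) (x : Fin m → Vec d) (y : Fin m → ℝ) :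
    ∃ f ∈ cubicClass d k, IsMinOn (risk l x y) (cubicClass d k) f := by
  obtain ⟨g, hg⟩ := hiddenUnits_nonempty hd
  have hcont : Continuous fun z : Fin m → ℝ => (1 / (m : ℝ)) * ∑ i, l (z i) (y i) :=
    continuous_const.mul (continuous_finsetSum _ fun i _ => (hl (y i)).comp (continuous_apply i))
  obtain ⟨_, ⟨f, hf, rfl⟩, h⟩ := (isCompact_image_cubicClass x k).exists_isMinOn
    (Set.Nonempty.image _ ⟨_, fun _ => 0, fun _ => g, by simp, fun _ => hg, rfl⟩)
    hcont.continuousOn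
  exact ⟨f, hf, fun f' hf' => isMinOn_iff.1 h _ ⟨f', hf', rfl⟩⟩

/-! ### Smooth convex losses -/

lemma _root_.ConvexOn.add_deriv_mul_le {φ : ℝ → ℝ} (hc : ConvexOn ℝ Set.univ φ)
    (hd : Differentiable ℝ φ) (a b : ℝ) : φ a + deriv φ a * (b - a) ≤ φ b := by
  rcases lt_trichotomy a b with h | rfl | h
  · have := hc.deriv_le_slope (Set.mem_univ a) (Set.mem_univ b) h (hd a)
    rw [slope_def_field, le_div_iff₀ (by linarith)] at this
    linarith
  · simp
  · have := hc.slope_le_deriv (Set.mem_univ b) (Set.mem_univ a) h (hd a)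
    rw [slope_def_field, div_le_iff₀ (by linarith)] at this
    linarith

lemma IsSmoothWith.nonneg {β : ℝ} {φ : ℝ → ℝ} (h : IsSmoothWith β φ) : 0 ≤ β := by
  have := (abs_nonneg _).trans (h.2 1 0)
  simpa using this

lemma IsSmoothWith.continuous_deriv {β : ℝ} {φ : ℝ → ℝ} (h : IsSmoothWith β φ) :
    Continuous (deriv φ) :=
  (LipschitzWith.of_dist_le_mul (K := ⟨β, h.nonneg⟩) fun a b => by
    rw [Real.dist_eq, Real.dist_eq]
    exact h.2 a b).continuous

/-- The function `β / 2 * z ^ 2 - φ z` has monotone derivative, hence is convex and lies above its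
tangents. -/
lemma IsSmoothWith.le_add {β : ℝ} {φ : ℝ → ℝ} (h : IsSmoothWith β φ) (a b : ℝ) :
    φ b ≤ φ a + deriv φ a * (b - a) + β / 2 * (b - a) ^ 2 := by
  have hder : ∀ z, HasDerivAt (fun z => β / 2 * z ^ 2 - φ z) (β * z - deriv φ z) z := fun z => by
    have hβ : β * z = β / 2 * ((2 : ℕ) * z ^ (2 - 1)) := by
      push_cast
      ring
    rw [hβ]
    exact ((hasDerivAt_pow 2 z).const_mul (β / 2)).sub (h.1 z).hasDerivAt
  have hdiff : Differentiable ℝ fun z => β / 2 * z ^ 2 - φ z := fun z => (hder z).differentiableAt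
  have hmono : Monotone (deriv fun z => β / 2 * z ^ 2 - φ z) := by
    intro z z' hz
    rw [(hder z).deriv, (hder z').deriv]
    have := (le_abs_self _).trans (h.2 z' z)
    rw [abs_of_nonneg (sub_nonneg.2 hz)] at this
    linarith
  have := (hmono.convexOn_univ_of_deriv hdiff).add_deriv_mul_le hdiff a b
  rw [(hder a).deriv] at this
  linarith

lemma risk_add_smul_le {d m : ℕ} {l : ℝ → ℝ → ℝ} {β : ℝ}
    (hl : ∀ y, IsSmoothWith β fun z => l z y) (x : Fin m → Vec d) (y : Fin m → ℝ)
    (f g : Vec d → ℝ) (η : ℝ) :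
    risk l x y (f + η • g) ≤ risk l x y f + η * riskSlope l x y f g +
      β / 2 * η ^ 2 * ((1 / (m : ℝ)) * ∑ i, g (x i) ^ 2) := by
  have h : ∀ i, l ((f + η • g) (x i)) (y i) ≤ l (f (x i)) (y i) +
      η * (deriv (fun z => l z (y i)) (f (x i)) * g (x i)) + β / 2 * η ^ 2 * g (x i) ^ 2 := by
    intro i
    have := (hl (y i)).le_add (f (x i)) ((f + η • g) (x i))
    simp only [Pi.add_apply, Pi.smul_apply, smul_eq_mul, add_sub_cancel_left] at this ⊢
    linarith
  have hs := mul_le_mul_of_nonneg_left (Finset.sum_le_sum fun i (_ : i ∈ Finset.univ) => h i)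
    (by positivity : (0 : ℝ) ≤ 1 / (m : ℝ))
  simp only [Finset.sum_add_distrib, ← Finset.mul_sum] at hs
  unfold risk riskSlope
  linarith

lemma risk_add_riskSlope_le {d m : ℕ} {l : ℝ → ℝ → ℝ}
    (hc : ∀ y, ConvexOn ℝ Set.univ fun z => l z y) (hl : ∀ y, Differentiable ℝ fun z => l z y)
    (x : Fin m → Vec d) (y : Fin m → ℝ) (f h : Vec d → ℝ) :
    risk l x y f + (riskSlope l x y f h - riskSlope l x y f f) ≤ risk l x y h := by
  have hi : ∀ i, l (f (x i)) (y i) + (deriv (fun z => l z (y i)) (f (x i)) * h (x i) -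
      deriv (fun z => l z (y i)) (f (x i)) * f (x i)) ≤ l (h (x i)) (y i) := by
    intro i
    have := (hc (y i)).add_deriv_mul_le (hl (y i)) (f (x i)) (h (x i))
    linarith
  have hs := mul_le_mul_of_nonneg_left (Finset.sum_le_sum fun i (_ : i ∈ Finset.univ) => hi i)
    (by positivity : (0 : ℝ) ≤ 1 / (m : ℝ))
  simp only [Finset.sum_add_distrib, Finset.sum_sub_distrib] at hs
  unfold risk riskSlope
  linarith

lemma riskSlope_self_eq_zero {d m : ℕ} {l : ℝ → ℝ → ℝ} {β : ℝ}
    (hl : ∀ y, IsSmoothWith β fun z => l z y) (x : Fin m → Vec d) (y : Fin m → ℝ)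
    {f : Vec d → ℝ} (hf : ∀ η : ℝ, risk l x y f ≤ risk l x y (f + η • f)) :
    riskSlope l x y f f = 0 := by
  set s := riskSlope l x y f f
  set C := β / 2 * ((1 / (m : ℝ)) * ∑ i, f (x i) ^ 2)
  have hC : 0 ≤ C := mul_nonneg (by linarith [(hl 0).nonneg]) (by positivity)
  -- Along `f` the risk changes by at most `η s + C η ^ 2`, which at this `η` equals `-(s / (C + 1))
  -- ^ 2`; the `+ 1` covers `C = 0`.
  have h := (hf (-s / (C + 1))).trans (risk_add_smul_le hl x y f f _)
  have h' : 0 ≤ -(s / (C + 1)) ^ 2 := by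
    have : -s / (C + 1) * s + (-s / (C + 1)) ^ 2 * C = -(s / (C + 1)) ^ 2 := by
      field_simp
      ring
    have hCη : β / 2 * (-s / (C + 1)) ^ 2 * ((1 / (m : ℝ)) * ∑ i, f (x i) ^ 2) =
        (-s / (C + 1)) ^ 2 * C := by
      simp only [C]
      ring
    rw [hCη] at h
    rw [← this]
    linarith
  have h0 : s / (C + 1) = 0 := by
    by_contra hne
    have := pow_pos (abs_pos.2 hne) 2
    rw [sq_abs] at this
    linarith
  rcases div_eq_zero_iff.1 h0 with h0 | h0
  · exact h0
  · linarith

/-! ### The greedy step -/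

/-- Negating one factor suffices. The symmetry lets positive slopes control coefficients of either
sign. -/
lemma neg_mem_hiddenUnits {d : ℕ} {g : Vec d → ℝ} (hg : g ∈ hiddenUnits d) :
    -g ∈ hiddenUnits d := by
  have key : ∀ n, g ∈ unitProducts d (n + 1) → -g ∈ unitProducts d (n + 1) := by
    rintro n ⟨w, hw, rfl⟩
    refine ⟨Fin.cons (-w 0) fun j => w j.succ, fun j => ?_, ?_⟩
    · refine Fin.cases ?_ (fun j => ?_) j
      · simpa using hw 0
      · simpa using hw j.succ
    · funext z
      simp [linProd, Fin.prod_univ_succ]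
  rcases hg with (hg | hg) | hg
  · exact Or.inl (Or.inl (key 0 hg))
  · exact Or.inl (Or.inr (key 1 hg))
  · exact Or.inr (key 2 hg)

lemma linProd_one_mem_hiddenUnits {d : ℕ} {a : Vec d} (ha : ‖a‖ = 1) :
    linProd ![a] ∈ hiddenUnits d :=
  Or.inl (Or.inl ⟨_, by simpa using ha, rfl⟩)

lemma linProd_two_mem_hiddenUnits {d : ℕ} {a b : Vec d} (ha : ‖a‖ = 1) (hb : ‖b‖ = 1) :
    linProd ![a, b] ∈ hiddenUnits d :=
  Or.inl (Or.inr ⟨_, by simp [Fin.forall_fin_two, ha, hb], rfl⟩)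

lemma linProd_three_mem_hiddenUnits {d : ℕ} {a b c : Vec d} (ha : ‖a‖ = 1) (hb : ‖b‖ = 1)
    (hc : ‖c‖ = 1) : linProd ![a, b, c] ∈ hiddenUnits d :=
  Or.inr ⟨_, by intro j; fin_cases j <;> simp [ha, hb, hc], rfl⟩

lemma riskSlope_neg {d m : ℕ} (l : ℝ → ℝ → ℝ) (x : Fin m → Vec d) (y : Fin m → ℝ)
    (f g : Vec d → ℝ) : riskSlope l x y f (-g) = -riskSlope l x y f g := by
  simp [riskSlope]

lemma riskSlope_sum_mul {d m k : ℕ} (l : ℝ → ℝ → ℝ) (x : Fin m → Vec d) (y : Fin m → ℝ)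
    (f : Vec d → ℝ) (a : Fin k → ℝ) (g : Fin k → Vec d → ℝ) :
    riskSlope l x y f (fun z => ∑ j, a j * g j z) = ∑ j, a j * riskSlope l x y f (g j) := by
  simp only [riskSlope, Finset.mul_sum]
  rw [Finset.sum_comm]
  exact Finset.sum_congr rfl fun j _ => Finset.sum_congr rfl fun i _ => by ring

lemma IsGreedyChoice.mem_hiddenUnits {d m s : ℕ} {τ : ℝ} {l : ℝ → ℝ → ℝ} {x : Fin m → Vec d}
    {y : Fin m → ℝ} {W : Fin s → Vec d} {f g : Vec d → ℝ}
    (h : IsGreedyChoice τ l x y W f g) (hW : ∀ i, W i ≠ 0) : g ∈ hiddenUnits d := by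
  obtain ⟨a, b, c, w, u, v, ⟨ha, -⟩, ⟨hb, hc, -⟩, ⟨us, vs, huv, j, -, rfl, rfl, rfl⟩,
    rfl | rfl | rfl, -⟩ := h
  · exact linProd_one_mem_hiddenUnits ha
  · exact linProd_two_mem_hiddenUnits hb hc
  · exact linProd_three_mem_hiddenUnits (norm_normalized (hW j)) (huv j).1 (huv j).2.1

/-- The weights of the first order term of the risk at `f`. -/
def lossDerivs {d m : ℕ} (l : ℝ → ℝ → ℝ) (x : Fin m → Vec d) (y : Fin m → ℝ) (f : Vec d → ℝ) :
    Fin m → ℝ :=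
  fun i => deriv (fun z => l z (y i)) (f (x i))

lemma IsGreedyChoice.riskSlope_le {d m s : ℕ} (hd : 0 < d) {τ : ℝ} (hτ1 : τ < 1)
    {l : ℝ → ℝ → ℝ} {x : Fin m → Vec d} {y : Fin m → ℝ} {W : Fin s → Vec d} {f g : Vec d → ℝ}
    (h : IsGreedyChoice τ l x y W f g) (hW : (lossDerivs l x y f, W) ∈ goodDraws s x)
    {h' : Vec d → ℝ} (hh : h' ∈ hiddenUnits d) :
    (1 - τ) * riskSlope l x y f h' ≤ √(2 * d) * riskSlope l x y f g := by
  obtain ⟨a, b, c, w, u, v, ⟨ha, hamax⟩, ⟨-, -, hbc⟩, ⟨us, vs, huv, j, hj, rfl, rfl, rfl⟩,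
    -, h1, h2, h3⟩ := h
  -- A negative slope at `a` would be beaten by the competitor `-a`, even up to the factor `1 - τ`.
  have h0 : 0 ≤ riskSlope l x y f g := by
    refine le_trans ?_ h1
    have hneg : linProd ![-a] = -linProd ![a] := by funext z; simp [linProd_one]
    have := hamax (-a) (by rwa [norm_neg])
    rw [hneg, riskSlope_neg] at this
    by_contra! hlt
    nlinarith
  have hs : 1 ≤ √(2 * (d : ℝ)) := by
    rw [Real.one_le_sqrt]
    have : (1 : ℝ) ≤ d := by exact_mod_cast hd
    linarith
  have hle : riskSlope l x y f g ≤ √(2 * d) * riskSlope l x y f g := le_mul_of_one_le_left h0 hs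
  rcases hh with (⟨w', hw', rfl⟩ | ⟨w', hw', rfl⟩) | ⟨w', hw', rfl⟩
  · have := hamax (w' 0) (hw' 0)
    rw [show ![w' 0] = w' by ext i; fin_cases i; rfl] at this
    linarith
  · have := hbc (w' 0) (w' 1) (hw' 0) (hw' 1)
    simp only at this
    rw [show ![w' 0, w' 1] = w' by ext i; fin_cases i <;> rfl] at this
    linarith
  -- The pair from the good draw competes with the computed singular pair of the same direction `W
  -- i`, and the kept triple is at least as good.
  · obtain ⟨i, u, v, hu, hv, hgood⟩ := hW
    have hg : riskSlope l x y f (linProd w') ≤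
        √(2 * d) * riskSlope l x y f (linProd ![normalized (W i), u, v]) := by
      have := hgood (w' 0) (w' 1) (w' 2) (hw' 0) (hw' 1) (hw' 2)
      rw [show ![w' 0, w' 1, w' 2] = w' by ext i; fin_cases i <;> rfl] at this
      exact this
    have hi : (1 - τ) * riskSlope l x y f (linProd ![normalized (W i), u, v]) ≤
        riskSlope l x y f g := ((huv i).2.2 u v hu hv).trans ((hj i).trans h3)
    calc _ ≤ (1 - τ) * (√(2 * d) * riskSlope l x y f (linProd ![normalized (W i), u, v])) :=
          mul_le_mul_of_nonneg_left hg (by linarith)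
      _ = √(2 * d) * ((1 - τ) * riskSlope l x y f (linProd ![normalized (W i), u, v])) := by ring
      _ ≤ _ := mul_le_mul_of_nonneg_left hi (by positivity)

/-- The excess risk over the cubic class is controlled by the slope in the greedy direction. -/
lemma IsGreedyChoice.mul_excess_le {d m s k : ℕ} (hd : 0 < d) {τ : ℝ} (hτ1 : τ < 1)
    {l : ℝ → ℝ → ℝ} (hconv : ∀ y, ConvexOn ℝ Set.univ fun z => l z y)
    (hl : ∀ y, Differentiable ℝ fun z => l z y)
    {x : Fin m → Vec d} {y : Fin m → ℝ} {W : Fin s → Vec d} {f g : Vec d → ℝ}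
    (h : IsGreedyChoice τ l x y W f g) (hW : (lossDerivs l x y f, W) ∈ goodDraws s x)
    (hf : riskSlope l x y f f = 0) {fmin : Vec d → ℝ} (hmin : fmin ∈ cubicClass d k) :
    (1 - τ) * (risk l x y f - risk l x y fmin) ≤ (√(2 * d) * k) * riskSlope l x y f g := by
  have h1 := risk_add_riskSlope_le hconv hl x y f fmin
  obtain ⟨a, u, ha, hu, rfl⟩ := hmin
  rw [hf, sub_zero, riskSlope_sum_mul] at h1
  have hτ : 0 < 1 - τ := by linarith
  have habs : ∀ j, (1 - τ) * (-(a j * riskSlope l x y f (u j))) ≤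
      √(2 * d) * riskSlope l x y f g := by
    intro j
    have hp := h.riskSlope_le hd hτ1 hW (hu j)
    have hn := h.riskSlope_le hd hτ1 hW (neg_mem_hiddenUnits (hu j))
    rw [riskSlope_neg] at hn
    have hb : (1 - τ) * |riskSlope l x y f (u j)| ≤ √(2 * d) * riskSlope l x y f g := by
      rcases abs_choice (riskSlope l x y f (u j)) with h | h <;> rw [h] <;> assumption
    refine le_trans (mul_le_mul_of_nonneg_left ?_ hτ.le) hb
    calc -(a j * riskSlope l x y f (u j)) ≤ |a j * riskSlope l x y f (u j)| := neg_le_abs _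
      _ = |a j| * |riskSlope l x y f (u j)| := abs_mul _ _
      _ ≤ _ := mul_le_of_le_one_left (abs_nonneg _) (ha j)
  calc _ ≤ (1 - τ) * -∑ j, a j * riskSlope l x y f (u j) :=
        mul_le_mul_of_nonneg_left (by linarith) hτ.le
    _ = ∑ j, (1 - τ) * (-(a j * riskSlope l x y f (u j))) := by
      rw [← Finset.sum_neg_distrib, Finset.mul_sum]
    _ ≤ ∑ _j : Fin k, √(2 * d) * riskSlope l x y f g := Finset.sum_le_sum fun j _ => habs j
    _ = _ := by
      rw [Finset.sum_const, Finset.card_univ, Fintype.card_fin, nsmul_eq_mul]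
      ring

/-! ### The rate of convergence -/

/-- If every step has first order gain proportional to the current excess `Δ n`, up to a quadratic
error, then the excess decays like `1 / n`. -/
lemma nat_mul_excess_le {r : ℕ} {Δ D : ℕ → ℝ} {β κ K : ℝ} (hβ : 0 ≤ β) (hκ : 0 < κ)
    (hK : 0 ≤ K) (hstep : ∀ t < r, ∀ η : ℝ, Δ (t + 1) ≤ Δ t - η * D t + β / 2 * η ^ 2)
    (hgain : ∀ t < r, κ * Δ t ≤ K * D t) :
    ∀ n ≤ r, n * (κ ^ 2 * Δ n) ≤ 2 * β * K ^ 2 := by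
  intro n
  induction n with
  | zero =>
    intro _
    simp only [Nat.cast_zero, zero_mul]
    positivity
  | succ n ih =>
    intro hn
    have ih := ih (by omega)
    have hstep := hstep n hn
    have hgain := hgain n hn
    by_cases hΔ : Δ n ≤ 0
    · have h0 := hstep 0
      have : (((n + 1 : ℕ) : ℝ)) * (κ ^ 2 * Δ (n + 1)) ≤ 0 :=
        mul_nonpos_of_nonneg_of_nonpos (by positivity)
          (mul_nonpos_of_nonneg_of_nonpos (by positivity) (by linarith))
      exact this.trans (by positivity)
    · push Not at hΔ
      have hKD : 0 < K * D n := lt_of_lt_of_le (by positivity) hgain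
      have hKpos : 0 < K := hK.lt_of_ne fun h => by simp [← h] at hKD
      have hD : 0 < D n := pos_of_mul_pos_right hKD hK
      -- If `β = 0`, a large enough step would force `Δ (n + 1) ≤ Δ (n + 1) - 1`.
      have hβpos : 0 < β := hβ.lt_of_ne fun h => by
        have := hstep ((Δ n - Δ (n + 1) + 1) / D n)
        rw [div_mul_cancel₀ _ hD.ne', ← h] at this
        linarith
      -- In this normalisation the recursion becomes `G' ≤ G - G ^ 2` and the claim `n * G ≤ 1`.
      set G := κ ^ 2 * Δ n / (2 * β * K ^ 2)
      set G' := κ ^ 2 * Δ (n + 1) / (2 * β * K ^ 2)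
      have hC : 0 < 2 * β * K ^ 2 := by positivity
      have hG : 0 < G := by positivity
      have hnG : n * G ≤ 1 := by
        rw [← mul_div_assoc, div_le_one hC]
        exact ih
      have hGG' : G' ≤ G - G ^ 2 := by
        -- This `η` minimizes `-η * (κ * Δ n / K) + β / 2 * η ^ 2`.
        have h := hstep (κ * Δ n / (β * K))
        have h2 : κ * Δ n / (β * K) * (κ * Δ n / K) ≤ κ * Δ n / (β * K) * D n := by
          refine mul_le_mul_of_nonneg_left ?_ (by positivity)
          rw [div_le_iff₀ hKpos]
          linarith
        have h3 : Δ (n + 1) ≤ Δ n - κ ^ 2 * Δ n ^ 2 / (2 * β * K ^ 2) := by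
          refine (h.trans (add_le_add_left (sub_le_sub_left h2 _) _)).trans (le_of_eq ?_)
          field_simp
          ring
        calc G' ≤ κ ^ 2 * (Δ n - κ ^ 2 * Δ n ^ 2 / (2 * β * K ^ 2)) / (2 * β * K ^ 2) := by
              simp only [G']
              gcongr
          _ = G - G ^ 2 := by
              simp only [G]
              field_simp
      have hfin : ((n + 1 : ℕ) : ℝ) * G' ≤ 1 := by
        have h1 : ((n + 1 : ℕ) : ℝ) * G' ≤ (n + 1 : ℕ) * (G - G ^ 2) :=
          mul_le_mul_of_nonneg_left hGG' (by positivity)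
        push_cast at h1 ⊢
        have h0 : 0 ≤ (n : ℝ) * G := by positivity
        -- With `a = 1 - n * G` in `[0, 1]`, one has `1 - (n + 1) * (G - G ^ 2) = (G - a / 2) ^ 2 +
        -- a - a ^ 2 / 4`.
        nlinarith [sq_nonneg (G - (1 - n * G) / 2)]
      rwa [← mul_div_assoc, div_le_one hC] at hfin

/-! ### Analysis of a run -/

lemma span_units_mono {d : ℕ} (g : ℕ → Vec d → ℝ) {s t : ℕ} (h : s ≤ t) :
    Submodule.span ℝ {h | ∃ j ≤ s, h = g j} ≤ Submodule.span ℝ {h | ∃ j ≤ t, h = g j} :=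
  Submodule.span_mono fun _ ⟨j, hj, e⟩ => ⟨j, hj.trans h, e⟩

/-- The risk of a run whose greedy choices are all made with good draws. -/
lemma nat_mul_excess_risk_le {d m k r s : ℕ} (hd : 0 < d) {l : ℝ → ℝ → ℝ} {β τ : ℝ} (hτ1 : τ < 1)
    (hconv : ∀ y, ConvexOn ℝ Set.univ fun z => l z y)
    (hsmooth : ∀ y, IsSmoothWith β fun z => l z y)
    {x : Fin m → Vec d} {y : Fin m → ℝ}
    (hnorm : ∀ g ∈ hiddenUnits d, (1 / (m : ℝ)) * ∑ i, g (x i) ^ 2 ≤ 1)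
    {W : ℕ → Fin s → Vec d} {g f : ℕ → Vec d → ℝ} (hinit : f 0 = 0)
    (hgreedy : ∀ t < r, IsGreedyChoice τ l x y (W t) (f t) (g t))
    (hrefit : ∀ t < r, IsRefit l x y g t (f (t + 1)))
    (hunit : ∀ t < r, g t ∈ hiddenUnits d)
    (hgood : ∀ t < r, (lossDerivs l x y (f t), W t) ∈ goodDraws s x)
    {fmin : Vec d → ℝ} (hmin : fmin ∈ cubicClass d k) :
    r * ((1 - τ) ^ 2 * (risk l x y (f r) - risk l x y fmin)) ≤ 4 * d * β * k ^ 2 := by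
  have hβ : 0 ≤ β := (hsmooth 0).nonneg
  have hself : ∀ t < r, riskSlope l x y (f t) (f t) = 0 := by
    rintro (_ | t) ht
    · simp [hinit, riskSlope]
    · obtain ⟨hmem, hopt⟩ := hrefit t (by omega)
      exact riskSlope_self_eq_zero hsmooth x y fun η =>
        hopt _ (add_mem hmem (Submodule.smul_mem _ _ hmem))
  have hspan : ∀ t < r, f t ∈ Submodule.span ℝ {h | ∃ j ≤ t, h = g j} := by
    rintro (_ | t) ht
    · rw [hinit]
      exact zero_mem _
    · exact span_units_mono g t.le_succ (hrefit t (by omega)).1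
  have h := nat_mul_excess_le (r := r) (Δ := fun t => risk l x y (f t) - risk l x y fmin)
    (D := fun t => riskSlope l x y (f t) (g t)) (β := β) (κ := 1 - τ) (K := √(2 * d) * k)
    hβ (by linarith) (by positivity) ?_ ?_ r le_rfl
  · refine h.trans (le_of_eq ?_)
    rw [mul_pow, Real.sq_sqrt (by positivity)]
    ring
  · intro t ht η
    -- The refit is at least as good as any single step from `f t` along `g t`.
    have h1 := (hrefit t ht).2 (f t + (-η) • g t) (add_mem (hspan t ht)
      (Submodule.smul_mem _ _ (Submodule.subset_span ⟨t, le_rfl, rfl⟩)))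
    have h2 := risk_add_smul_le hsmooth x y (f t) (g t) (-η)
    have h3 := mul_le_mul_of_nonneg_left (hnorm _ (hunit t ht))
      (by positivity : 0 ≤ β / 2 * (-η) ^ 2)
    simp only [neg_sq, mul_one] at h2 h3
    linarith
  · intro t ht
    exact (hgreedy t ht).mul_excess_le hd hτ1 hconv (fun y => (hsmooth y).1) (hgood t ht)
      (hself t ht) hmin

lemma IsGecoRun.ae_draws_ne_zero {d m r : ℕ} {Ω : Type*} [MeasurableSpace Ω] {μ : Measure Ω}
    {ℱ : Filtration ℕ (‹MeasurableSpace Ω› : MeasurableSpace Ω)} {τ δ : ℝ} {l : ℝ → ℝ → ℝ}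
    {x : Fin m → Vec d} {y : Fin m → ℝ} {W : ℕ → Ω → Fin (numDirections d δ) → Vec d}
    {g f : ℕ → Ω → Vec d → ℝ} (hrun : IsGecoRun μ ℱ τ δ l x y r W g f) (hd : 0 < d) :
    ∀ t < r, ∀ᵐ ω ∂μ, ∀ i, W t ω i ≠ 0 := by
  intro t ht
  have hW : Measurable (W t) := (hrun.drawn t ht).mono (ℱ.le _) le_rfl
  refine ae_of_ae_map hW.aemeasurable (p := fun w => ∀ i, w i ≠ 0) ?_
  rw [hrun.law t ht]
  exact ae_all_iff.2 fun i => (measurePreserving_eval (fun _ => stdGaussian (Vec d))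
    i).quasiMeasurePreserving.ae (stdGaussian_ae_ne_zero hd)

end PolyNet

end

/-! ### The probabilistic and the deterministic estimate combined -/

open PolyNet in
theorem mainTheorem4 {d m k r : ℕ} (hd : 0 < d)
    (l : ℝ → ℝ → ℝ) (β ε δ τ : ℝ)
    (hε : 0 < ε) (hδ0 : 0 < δ) (hδ1 : δ < 1) (hτ0 : 0 ≤ τ) (hτ1 : τ < 1)
    (hconv : ∀ y : ℝ, ConvexOn ℝ Set.univ (fun z => l z y))
    (hsmooth : ∀ y : ℝ, PolyNet.IsSmoothWith β (fun z => l z y))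
    (x : Fin m → PolyNet.Vec d) (y : Fin m → ℝ)
    (hnorm : ∀ g ∈ PolyNet.hiddenUnits d, (1 / (m : ℝ)) * ∑ i, g (x i) ^ 2 ≤ 1)
    (hr : (r : ℝ) > 4 * d * β * k ^ 2 / (ε * (1 - τ) ^ 2))
    {Ω : Type*} [MeasurableSpace Ω] (μ : Measure Ω) [IsProbabilityMeasure μ]
    (ℱ : Filtration ℕ (‹MeasurableSpace Ω› : MeasurableSpace Ω))
    (W : ℕ → Ω → Fin (PolyNet.numDirections d δ) → PolyNet.Vec d)
    (g f : ℕ → Ω → PolyNet.Vec d → ℝ)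
    (hrun : PolyNet.IsGecoRun μ ℱ τ δ l x y r W g f) :
    ∃ fmin ∈ PolyNet.cubicClass d k,
      IsMinOn (PolyNet.risk l x y) (PolyNet.cubicClass d k) fmin ∧
      (1 - δ) ^ r ≤ μ.real {ω | f r ω ∈ PolyNet.networkClass d 3 (5 * r) PolyNet.sqAct ∧
        PolyNet.risk l x y (f r ω) ≤ PolyNet.risk l x y fmin + ε} := by
  obtain ⟨fmin, hmem, hmin⟩ := exists_isMinOn_risk hd k (fun y => (hsmooth y).1.continuous) x y
  refine ⟨fmin, hmem, hmin, ?_⟩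
  have hβ : 0 ≤ β := (hsmooth 0).nonneg
  have hτ : 0 < 1 - τ := by linarith
  have hrpos : 0 < r := by
    have : (0 : ℝ) < r := lt_of_le_of_lt (by positivity) hr
    exact_mod_cast this
  have hprob : (1 - δ) ^ r ≤ μ.real {ω | ∀ t < r,
      (lossDerivs l x y (f t ω), W t ω) ∈ goodDraws (numDirections d δ) x} := by
    refine pow_le_measureReal_forall_mem ℱ (X := fun t ω => lossDerivs l x y (f t ω))
      (fun t ht => ?_) hrun.drawn hrun.law hrun.fresh (measurableSet_goodDraws _ x) (by linarith)
      (le_pi_goodDraws hd hδ0 x)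
    refine @measurable_pi_lambda _ _ _ (ℱ t) _ _ fun i => ?_
    exact (hsmooth (y i)).continuous_deriv.measurable.comp (hrun.adapted t ht.le (x i))
  -- Monotonicity of the outer measure suffices, so the success event need not be measurable.
  refine hprob.trans (ENNReal.toReal_mono (measure_ne_top _ _) (measure_mono_ae ?_))
  have hgreedy : ∀ᵐ ω ∂μ, ∀ t < r, IsGreedyChoice τ l x y (W t ω) (f t ω) (g t ω) :=
    ae_all_iff.2 fun t => ae_all_iff.2 (hrun.greedy t)
  have hrefit : ∀ᵐ ω ∂μ, ∀ t < r, IsRefit l x y (fun j => g j ω) t (f (t + 1) ω) :=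
    ae_all_iff.2 fun t => ae_all_iff.2 (hrun.refit t)
  have hne : ∀ᵐ ω ∂μ, ∀ t < r, ∀ i, W t ω i ≠ 0 :=
    ae_all_iff.2 fun t => ae_all_iff.2 (hrun.ae_draws_ne_zero hd t)
  filter_upwards [hrun.init, hgreedy, hrefit, hne] with ω hi hg hf hW hgood
  have hunit : ∀ t < r, g t ω ∈ hiddenUnits d := fun t ht => (hg t ht).mem_hiddenUnits (hW t ht)
  constructor
  -- The output after `q + 1` iterations is a combination of the `q + 1` units `g 0, …, g q`.
  · obtain ⟨q, rfl⟩ := Nat.exists_eq_add_one.2 hrpos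
    exact mem_networkClass_of_mem_span (fun j hj => hunit j (by omega)) (hf q (by omega)).1
  · have h := nat_mul_excess_risk_le (W := fun t => W t ω) (g := fun t => g t ω)
      (f := fun t => f t ω) hd hτ1 hconv hsmooth hnorm hi hg hf hunit hgood hmem
    by_contra! hlt
    rw [gt_iff_lt, div_lt_iff₀ (by positivity)] at hr
    have h2 : (r : ℝ) * (ε * (1 - τ) ^ 2) ≤
        r * ((1 - τ) ^ 2 * (risk l x y (f r ω) - risk l x y fmin)) := by
      rw [mul_comm ε]
      gcongr
      linarith
    linarith
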